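/- Let $h\in\mathbb N$, let $k_1,\dots,k_h$ be integers with $k_i>8$ for all $i$, and put $n=\prod_i k_i$. Let $\mathcal T$ be the rooted tree with levels $0,\dots,h$ (the root on level $h$, the $n$ leaves on level $0$) in which every node on level $i\ge 1$ has exactly $k_i$ children. Let $\mathrm{Aut}(\mathcal T)$ be its automorphism group as a rooted tree; it acts on the leaves, which index the variables $x_1,\dots,x_n$. A block of $\mathcal T$ is a set of the form $B(v)=\{w : w \text{ and } v \text{ have the same parent}\}$ for a node $v$ (for the root, $B(v)=\{v\}$). For a positive integer $m$, a $\mathrm{MOD}_m$-circuit $C$ is a finite directed acyclic multigraph with vertex set $V(C)$ (the gates) and a designated root. The gates without incoming edges are the input gates and are labelled with variables so that every variable labels exactly one input gate; every other gate is labelled with a set $R\subseteq\mathbb Z_m$ (standing for the operation that outputs $1$ iff the sum of its inputs modulo $m$ lies in $R$). An automorphism of $C$ is a permutation of $V(C)$ that preserves edge multiplicities and the labels of all internal gates. $C$ is $\mathrm{Aut}(\mathcal T)$-symmetric if for every $\pi\in\mathrm{Aut}(\mathcal T)$ there is an automorphism of $C$ that extends $\pi$, i.e. that maps the input gate labelled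 $x$ to the input gate labelled $\pi(x)$, for every variable $x$. $C$ is rigid if this automorphism is always unique. Then $\mathrm{Aut}(\mathcal T)$ acts on $V(C)$; for a gate $g$ let $\mathrm{Stab}(g)\le\mathrm{Aut}(\mathcal T)$ be its stabiliser. For $\Delta\le\mathrm{Aut}(\mathcal T)$ let $\mathrm{maxOrb}_\Delta(C)$ be the maximum size of a $\Delta$-orbit on $V(C)$. For a block $B$, let $\mathrm{Stab}(B)\le\mathrm{Aut}(\mathcal T)$ be its setwise stabiliser. A set $S\subseteq B$ is a $B$-support of a subgroup $\Delta\le\mathrm{Aut}(\mathcal T)$ if for every $\pi\in\mathrm{Sym}(B)$ that fixes $S$ pointwise there is a $\sigma\in\Delta$ with $\sigma(B)=B$ and $\sigma|_B=\pi$. **Lemma.** Let $C$ be an $\mathrm{Aut}(\mathcal T)$-symmetric rigid $\mathrm{MOD}_m$-circuit. Let $B$ be a block of $\mathcal T$ and let $k_B$ be an integer with $1\le k_B\le |B|/4$ and $$\mathrm{maxOrb}_{\mathrm{Stab}(B)}(C)<\binom{|B|}{k_B}.$$ Then for every gate $g\in V(C)$, the group $\mathrm{Stab}(g)$ has a $B$-support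 $S\subseteq B$ with $|S|<k_B$. -/

import Mathlib

open scoped Pointwise

/-! ### The symmetric tree and its automorphism group -/

/-- Vertices of the rooted tree with levels `0, …, h` (leaves on level `0`, the root on level `h`)
in which every node on level `i + 1` has `k i` children. A node on level `j` is given by the
choices of a child made at its ancestors on the levels `h, h - 1, …, j + 1`. -/
abbrev TreeNode {h : ℕ} (k : Fin h → ℕ) : Type :=
  Σ j : Fin (h + 1), (i : {i : Fin h // (j : ℕ) ≤ (i : ℕ)}) → Fin (k i)

namespace TreeNode

variable {h : ℕ} {k : Fin h → ℕ}

/-- The level of a node. -/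
def level (v : TreeNode k) : ℕ := v.1

/-- `IsChild w v`: the node `w` is a child of the node `v`. -/
def IsChild (w v : TreeNode k) : Prop :=
  w.level + 1 = v.level ∧
    ∀ (i : Fin h) (hw : (w.1 : ℕ) ≤ i) (hv : (v.1 : ℕ) ≤ i), w.2 ⟨i, hw⟩ = v.2 ⟨i, hv⟩

/-- The block of `v`: all nodes (including `v`) that have the same parent as `v`. -/
def block (v : TreeNode k) : Set (TreeNode k) :=
  {w | ∀ p, IsChild w p ↔ IsChild v p}

theorem level_le (v : TreeNode k) : v.level ≤ h := Nat.lt_succ_iff.mp v.1.2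

theorem exists_isChild {v : TreeNode k} (hv : v.level < h) : ∃ p, IsChild v p :=
  ⟨⟨⟨v.level + 1, by omega⟩, fun i => v.2 ⟨i, (Nat.le_succ _).trans i.2⟩⟩, rfl, fun _ _ _ => rfl⟩

end TreeNode

/-- The set of all blocks of the tree. -/
def treeBlocks {h : ℕ} (k : Fin h → ℕ) : Set (Set (TreeNode k)) :=
  Set.range TreeNode.block

/-- The automorphism group of the rooted tree, as a group of permutations of its vertices. -/
def treeAut {h : ℕ} (k : Fin h → ℕ) : Subgroup (Equiv.Perm (TreeNode k)) where
  carrier := {σ | ∀ w v, TreeNode.IsChild (σ w) (σ v) ↔ TreeNode.IsChild w v}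
  one_mem' := fun _ _ => Iff.rfl
  mul_mem' := fun {a b} ha hb w v => (ha (b w) (b v)).trans (hb w v)
  inv_mem' := fun {a} ha w v => by
    simpa using (ha (a⁻¹ w) (a⁻¹ v)).symm

theorem treeAut_level {h : ℕ} {k : Fin h → ℕ} (σ : treeAut k) (v : TreeNode k) :
    (σ • v).level = v.level := by
  have key : ∀ (τ : treeAut k) (d : ℕ) (v : TreeNode k), v.level + d = h →
      (τ • v).level ≤ v.level := by
    intro τ d
    induction d with
    | zero =>
      intro v hv
      have := (τ • v).level_le
      omega
    | succ d ih =>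
      intro v hv
      obtain ⟨p, hp⟩ := TreeNode.exists_isChild (v := v) (by omega)
      have hp' : TreeNode.IsChild (τ • v) (τ • p) := (τ.2 v p).mpr hp
      have h1 := hp.1
      have h2 := hp'.1
      have h3 := ih p (by omega)
      omega
  have hle : ∀ (τ : treeAut k) (v : TreeNode k), (τ • v).level ≤ v.level := fun τ v =>
    key τ (h - v.level) v (by have := v.level_le; omega)
  refine le_antisymm (hle σ v) ?_
  simpa using hle σ⁻¹ (σ • v)

/-- The leaves of the tree, i.e. the nodes on level `0`; they index the variables. -/
abbrev TreeLeaf {h : ℕ} (k : Fin h → ℕ) : Type := {v : TreeNode k // v.level = 0}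

/-- The action of the automorphism group on the leaves. -/
instance treeLeafAction {h : ℕ} (k : Fin h → ℕ) : MulAction (treeAut k) (TreeLeaf k) where
  smul σ v := ⟨σ • v.1, (treeAut_level σ v.1).trans v.2⟩
  one_smul v := Subtype.ext (one_smul _ v.1)
  mul_smul σ τ v := Subtype.ext (mul_smul σ τ v.1)

/-! ### Blockwise supports -/

/-- `Δ|_B`: all permutations of `B` that are induced by some `σ ∈ Δ` fixing `B` setwise. -/
def blockRestrict {h : ℕ} {k : Fin h → ℕ} (Δ : Subgroup (treeAut k)) (B : Set (TreeNode k)) :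
    Subgroup (Equiv.Perm B) where
  carrier := {π | ∃ σ ∈ Δ, σ • B = B ∧ ∀ b : B, σ • (b : TreeNode k) = π b}
  one_mem' := ⟨1, Δ.one_mem, one_smul _ B, fun _ => rfl⟩
  mul_mem' := by
    rintro a b ⟨σ, hσ, hσB, hσa⟩ ⟨τ, hτ, hτB, hτb⟩
    refine ⟨σ * τ, Δ.mul_mem hσ hτ, by rw [mul_smul, hτB, hσB], fun x => ?_⟩
    rw [mul_smul, hτb, hσa]
    rfl
  inv_mem' := by
    rintro a ⟨σ, hσ, hσB, hσa⟩
    refine ⟨σ⁻¹, Δ.inv_mem hσ, by rw [inv_smul_eq_iff, hσB], fun x => ?_⟩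
    rw [inv_smul_eq_iff, hσa]
    simp

/-- `S ⊆ B` is a `B`-support of `Δ` if the pointwise stabiliser of `S` in `Sym(B)` is contained
in `Δ|_B`. -/
def IsBlockSupport {h : ℕ} {k : Fin h → ℕ} (Δ : Subgroup (treeAut k)) (B S : Set (TreeNode k)) :
    Prop :=
  S ⊆ B ∧ fixingSubgroup (Equiv.Perm B) {b : B | (b : TreeNode k) ∈ S} ≤ blockRestrict Δ B

/-! ### Symmetric modular circuits -/

/-- A `MOD_m`-circuit with gate set `V` and variables indexed by `X`. `mult g g'` is the number of
wires from `g` to `g'`. An input gate is labelled with a variable, an internal gate with a set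
`R ⊆ ℤ/m`, standing for the operation that outputs `1` iff the sum of its inputs modulo `m`
is in `R`. -/
structure ModCircuit (m : ℕ) (X V : Type*) where
  mult : V → V → ℕ
  acyclic : ∀ g, ¬ Relation.TransGen (fun a b => 0 < mult a b) g g
  root : V
  label : V → X ⊕ Set (ZMod m)
  input_iff : ∀ g, (∃ x, label g = Sum.inl x) ↔ ∀ g', mult g' g = 0
  existsUnique_input : ∀ x, ∃! g, label g = Sum.inl x

namespace ModCircuit

variable {m : ℕ} {X V : Type*} (C : ModCircuit m X V) (Γ : Type*) [Group Γ] [MulAction Γ X]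

/-- Circuit automorphisms: the operations of internal gates and the multiplicities of all wires
are preserved. -/
def IsAutomorphism (σ : Equiv.Perm V) : Prop :=
  (∀ g R, C.label g = Sum.inr R → C.label (σ g) = Sum.inr R) ∧
    ∀ g g', C.mult (σ g) (σ g') = C.mult g g'

variable {Γ} in
/-- The circuit automorphism `σ` extends the action of `π` on the input gates. -/
def Extends (π : Γ) (σ : Equiv.Perm V) : Prop :=
  (∀ g x, C.label g = Sum.inl x → C.label (σ g) = Sum.inl (π • x)) ∧ C.IsAutomorphism σ

/-- `C` is `Γ`-symmetric: every `π ∈ Γ` extends to a circuit automorphism. -/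
def IsSymmetric : Prop := ∀ π : Γ, ∃ σ, C.Extends π σ

/-- `C` is rigid: for every `π ∈ Γ`, the circuit automorphism extending `π` is unique. -/
def IsRigid : Prop := ∀ (π : Γ) (σ σ' : Equiv.Perm V), C.Extends π σ → C.Extends π σ' → σ = σ'

variable {Γ} {C}

theorem Extends.mul {π π' : Γ} {σ σ' : Equiv.Perm V} (hσ : C.Extends π σ)
    (hσ' : C.Extends π' σ') : C.Extends (π * π') (σ * σ') := by
  refine ⟨fun g x hg => ?_, fun g R hg => ?_, fun g g' => ?_⟩
  · rw [mul_smul]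
    exact hσ.1 _ _ (hσ'.1 g x hg)
  · exact hσ.2.1 _ _ (hσ'.2.1 g R hg)
  · exact (hσ.2.2 _ _).trans (hσ'.2.2 g g')

theorem Extends.one : C.Extends (1 : Γ) 1 :=
  ⟨fun g x hg => by simpa using hg, fun _ _ hg => hg, fun _ _ => rfl⟩

/-- The action of `Γ` on the gates of a `Γ`-symmetric rigid circuit: `π` acts as the unique
circuit automorphism that extends it. -/
noncomputable def gateAction (hs : C.IsSymmetric Γ) (hr : C.IsRigid Γ) : Γ →* Equiv.Perm V where
  toFun π := (hs π).choose
  map_one' := hr 1 _ _ (hs 1).choose_spec Extends.one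
  map_mul' π π' := hr (π * π') _ _ (hs (π * π')).choose_spec
    ((hs π).choose_spec.mul (hs π').choose_spec)

/-- The stabiliser of a gate in `Γ`. -/
noncomputable def gateStab (hs : C.IsSymmetric Γ) (hr : C.IsRigid Γ) (g : V) : Subgroup Γ :=
  (MulAction.stabilizer (Equiv.Perm V) g).comap (gateAction hs hr)

/-- The orbit of a gate under a subgroup `Δ` of `Γ`. -/
def gateOrbit (hs : C.IsSymmetric Γ) (hr : C.IsRigid Γ) (Δ : Subgroup Γ) (g : V) : Set V :=
  {g' | ∃ π ∈ Δ, gateAction hs hr π g = g'}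

/-- The maximum size of a `Δ`-orbit of a gate. -/
noncomputable def maxOrb (hs : C.IsSymmetric Γ) (hr : C.IsRigid Γ) (Δ : Subgroup Γ) : ℕ :=
  ⨆ g : V, (gateOrbit hs hr Δ g).ncard

end ModCircuit

/-! Permuting the subtrees hanging below the parent of `B` lifts `Sym(B)` into `Aut(T)`, and thus to
an action on gates. Write `n = |B|` and `r = kB`. The orbit bound says that every gate stabiliser in
`Sym(B)` has index less than `n.choose r`. Two independent arguments then give the support.

Group theory (`exists_finset_forall_mem_of_index_lt`): a group `G` of such index contains the
alternating group on the complement of fewer than `r` points. An invariant set of size `j` forces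
index at least `n.choose j`, so some orbit `Γ` misses fewer than `r` points. The group induced on
`Γ` is transitive of small index. It cannot be imprimitive, since `a! ^ b * b! * (a * b).choose r ≤
(a * b)!`; being primitive, it contains a 3-cycle by Bochert's argument, hence `Alt(Γ)` by Jordan's
theorem. The elements of `G` supported on `Γ` form a group normalised by `Alt(Γ)` and of order above
2, so by simplicity it contains `Alt(Γ)`.

Rigidity (`gateAction_eq_of_forall_even`): odd permutations come for free. Send each gate to its
image under any odd permutation fixing its support. This is a circuit automorphism that fixes all
inputs, hence the identity. -/

namespace Nat

/-! ### Binomial and factorial estimates. -/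

theorem choose_le_choose_of_le_of_two_mul_le {n r j : ℕ} (hrj : r ≤ j) (hj : 2 * j ≤ n) :
    n.choose r ≤ n.choose j := by
  induction j, hrj using Nat.le_induction with
  | base => exact le_rfl
  | succ j _ ih =>
    exact (ih (by omega)).trans (Nat.choose_le_succ_of_lt_half_left (by omega))

theorem choose_le_choose_of_le_of_add_le {n r j : ℕ} (hrj : r ≤ j) (hj : r + j ≤ n) :
    n.choose r ≤ n.choose j := by
  rcases le_total (2 * j) n with h | h
  · exact choose_le_choose_of_le_of_two_mul_le hrj h
  · rw [← Nat.choose_symm (show j ≤ n by omega)]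
    exact choose_le_choose_of_le_of_two_mul_le (by omega) (by omega)

/-- While `n / 4` stays constant, one step multiplies `n.choose (n / 4)` by at most `4/3`; when it
jumps, the factor is exactly 4. Two consecutive steps thus cost at most `16/3 < 6`. -/
theorem three_mul_choose_quarter_succ_le {n : ℕ} (h : ¬ 4 ∣ n + 1) :
    3 * (n + 1).choose ((n + 1) / 4) ≤ 4 * n.choose (n / 4) := by
  have hk : (n + 1) / 4 = n / 4 := by omega
  rw [hk]
  have h1 := Nat.choose_mul_succ_eq n (n / 4)
  have h2 : 3 * (n + 1) ≤ 4 * (n + 1 - n / 4) := by omega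
  have h3 : 0 < n + 1 - n / 4 := by omega
  refine Nat.le_of_mul_le_mul_right ?_ h3
  calc _ = 3 * ((n + 1).choose (n / 4) * (n + 1 - n / 4)) := by ring
    _ = n.choose (n / 4) * (3 * (n + 1)) := by rw [← h1]; ring
    _ ≤ n.choose (n / 4) * (4 * (n + 1 - n / 4)) := by gcongr
    _ = _ := by ring

theorem choose_quarter_succ_le (n : ℕ) :
    (n + 1).choose ((n + 1) / 4) ≤ 4 * n.choose (n / 4) := by
  by_cases h : 4 ∣ n + 1
  · have hk : (n + 1) / 4 = n / 4 + 1 := by omega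
    rw [hk]
    have h1 := Nat.add_one_mul_choose_eq n (n / 4)
    refine Nat.le_of_mul_le_mul_right (c := n / 4 + 1) ?_ (by omega)
    rw [← h1]
    nth_rw 1 [show n + 1 = 4 * (n / 4 + 1) by omega]
    apply le_of_eq
    ring
  · have := three_mul_choose_quarter_succ_le h
    omega

theorem choose_quarter_add_two_le (n : ℕ) :
    (n + 2).choose ((n + 2) / 4) ≤ 6 * n.choose (n / 4) := by
  by_cases h : 4 ∣ n + 1
  · have h1 := three_mul_choose_quarter_succ_le (n := n + 1) (by omega)
    have h2 := choose_quarter_succ_le n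
    simp only [add_assoc, Nat.reduceAdd] at h1
    omega
  · have h1 := three_mul_choose_quarter_succ_le h
    have h2 := choose_quarter_succ_le (n + 1)
    simp only [add_assoc, Nat.reduceAdd] at h2
    omega

theorem choose_quarter_add_le (n a : ℕ) :
    (n + (a + 2)).choose ((n + (a + 2)) / 4) ≤ 6 * 4 ^ a * n.choose (n / 4) := by
  induction a with
  | zero => simpa using choose_quarter_add_two_le n
  | succ a ih =>
    have := choose_quarter_succ_le (n + (a + 2))
    rw [show n + (a + 1 + 2) = n + (a + 2) + 1 by ring, pow_succ]
    linarith

theorem six_mul_four_pow_le_choose (a : ℕ) : 6 * 4 ^ (a + 1) ≤ (3 * a + 8).choose (a + 2) := by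
  induction a with
  | zero => decide
  | succ a ih =>
    have h1 := Nat.add_one_mul_choose_eq (3 * a + 8) (a + 2)
    have h2 := Nat.choose_mul_succ_eq (3 * a + 9) (a + 3)
    have h3 : (3 * a + 10).choose (a + 3) ≤ (3 * a + 11).choose (a + 3) :=
      Nat.choose_le_choose _ (by omega)
    simp only [add_assoc, Nat.reduceAdd] at h1 h2
    rw [show 3 * a + 10 - (a + 3) = 2 * a + 7 by omega] at h2
    rw [show 3 * (a + 1) + 8 = 3 * a + 11 by ring, show a + 1 + 2 = a + 3 by ring]
    have h4 : 3 * (3 * a + 8).choose (a + 2) = (3 * a + 9).choose (a + 3) := by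
      refine Nat.eq_of_mul_eq_mul_right (show 0 < a + 3 by omega) ?_
      rw [← h1]; ring
    have h5 : 4 * (3 * a + 8).choose (a + 2) ≤ (3 * a + 10).choose (a + 3) := by
      refine Nat.le_of_mul_le_mul_right (c := 2 * a + 7) ?_ (by omega)
      rw [← h2, ← h4]
      nlinarith [Nat.zero_le ((3 * a + 8).choose (a + 2))]
    rw [pow_succ]
    omega

theorem two_mul_choose_quarter_le_centralBinom {a : ℕ} (ha : 3 ≤ a) :
    2 * (2 * a).choose (2 * a / 4) ≤ a.centralBinom := by
  rcases eq_or_lt_of_le ha with rfl | ha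
  · decide
  · refine le_trans ?_ (Nat.choose_le_centralBinom (2 * a / 4 + 1) a)
    have h := Nat.choose_succ_right_eq (2 * a) (2 * a / 4)
    refine Nat.le_of_mul_le_mul_right (c := 2 * a / 4 + 1) ?_ (by omega)
    rw [h]
    have : 2 * (2 * a / 4 + 1) ≤ 2 * a - 2 * a / 4 := by omega
    calc _ = (2 * a).choose (2 * a / 4) * (2 * (2 * a / 4 + 1)) := by ring
      _ ≤ _ := by gcongr

/-- With `n = a * b`, adding one more part multiplies `n! / (a! ^ b * b!)` by `(n + a - 1).choose (a
- 1)`, whereas `n.choose (n / 4)` grows by at most `6 * 4 ^ (a - 2)`. -/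
theorem factorial_pow_mul_factorial_mul_choose_step {a b : ℕ} (ha : 2 ≤ a)
    (hab : 6 * 4 ^ (a - 2) ≤ (a * b + a - 1).choose (a - 1))
    (h : a ! ^ b * b ! * (a * b).choose (a * b / 4) ≤ (a * b)!) :
    a ! ^ (b + 1) * (b + 1)! * (a * (b + 1)).choose (a * (b + 1) / 4) ≤ (a * (b + 1))! := by
  obtain ⟨c, rfl⟩ : ∃ c, a = c + 2 := ⟨a - 2, by omega⟩
  set n := (c + 2) * b with hn
  have h1 := choose_quarter_add_le n c
  rw [show (c + 2) * (b + 1) = n + (c + 2) by rw [hn]; ring]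
  rw [show n + (c + 2) - 1 = n + (c + 1) by omega, show c + 2 - 1 = c + 1 by omega,
    show c + 2 - 2 = c by omega] at hab
  have h2 := Nat.add_one_mul_choose_eq (n + (c + 1)) (c + 1)
  simp only [add_assoc, Nat.reduceAdd] at h2
  have h3 : (b + 1) * (n + (c + 1)).choose (c + 1) = (n + (c + 2)).choose (c + 2) := by
    refine Nat.eq_of_mul_eq_mul_right (show 0 < c + 2 by omega) ?_
    rw [← h2, hn]; ring
  have h4 := Nat.add_choose_mul_factorial_mul_factorial n (c + 2)
  calc _ ≤ (c + 2)! ^ (b + 1) * (b + 1)! * (6 * 4 ^ c * n.choose (n / 4)) := by gcongr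
    _ = ((c + 2)! ^ b * b ! * n.choose (n / 4)) * ((c + 2)! * ((b + 1) * (6 * 4 ^ c))) := by
      rw [Nat.factorial_succ b]; ring
    _ ≤ n ! * ((c + 2)! * ((b + 1) * (n + (c + 1)).choose (c + 1))) := by gcongr
    _ = _ := by rw [h3, ← h4]; ring

theorem factorial_pow_mul_factorial_mul_choose_quarter_le {a b : ℕ} (ha : 2 ≤ a) (hb : 2 ≤ b)
    (hab : 4 < a * b) : a ! ^ b * b ! * (a * b).choose (a * b / 4) ≤ (a * b)! := by
  rcases eq_or_lt_of_le ha with rfl | ha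
  -- The inequality fails at `a = b = 2`, so the induction for `a = 2` starts at `b = 3`.
  · have hb3 : 3 ≤ b := by omega
    clear hb hab
    induction b, hb3 using Nat.le_induction with
    | base => decide
    | succ b hb ih =>
      refine factorial_pow_mul_factorial_mul_choose_step le_rfl ?_ ih
      simp
      omega
  · clear hab
    induction b, hb using Nat.le_induction with
    | base =>
      have h1 := two_mul_choose_quarter_le_centralBinom ha
      have h2 := Nat.add_choose_mul_factorial_mul_factorial a a
      rw [← two_mul] at h2
      rw [mul_comm a 2]
      calc _ = (2 * (2 * a).choose (2 * a / 4)) * a ! * a ! := by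
              rw [show (2)! = 2 from rfl]; ring
        _ ≤ a.centralBinom * a ! * a ! := by gcongr
        _ = _ := h2
    | succ b hb ih =>
      refine factorial_pow_mul_factorial_mul_choose_step ha.le ?_ ih
      obtain ⟨c, rfl⟩ : ∃ c, a = c + 3 := ⟨a - 3, by omega⟩
      refine (six_mul_four_pow_le_choose c).trans ?_
      refine Nat.choose_le_choose _ ?_
      have : (c + 3) * 2 ≤ (c + 3) * b := by gcongr
      omega

theorem choose_quarter_le_factorial {n : ℕ} (hn : 9 ≤ n) :
    n.choose (n / 4) ≤ ((n + 1) / 2)! := by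
  induction n using Nat.strong_induction_on with
  | _ n ih =>
    rcases lt_or_ge n 11 with h | h
    · interval_cases n <;> decide
    · obtain ⟨m, rfl⟩ : ∃ m, n = m + 2 := ⟨n - 2, by omega⟩
      have h1 := ih m (by omega) (by omega)
      have h2 := choose_quarter_add_two_le m
      rw [show (m + 2 + 1) / 2 = (m + 1) / 2 + 1 by omega, Nat.factorial_succ]
      calc _ ≤ 6 * m.choose (m / 4) := h2
        _ ≤ _ := Nat.mul_le_mul (by omega) h1

theorem factorial_pow_mul_factorial_mul_choose_le {a b r : ℕ} (ha : 2 ≤ a) (hb : 2 ≤ b)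
    (hn : 8 ≤ a * b) (hr : 4 * r ≤ a * b) :
    a ! ^ b * b ! * (a * b).choose r ≤ (a * b)! := by
  refine le_trans ?_ (factorial_pow_mul_factorial_mul_choose_quarter_le ha hb (by omega))
  gcongr
  exact choose_le_choose_of_le_of_two_mul_le (by omega) (by omega)

/-- Degree 8 is exceptional because `choose 8 2 = 28` exceeds `4! = 24`. -/
theorem choose_le_factorial_half {n r : ℕ} (hn : 8 ≤ n) (hr : 4 * r ≤ n) (h8 : n = 8 → r ≤ 1) :
    n.choose r ≤ ((n + 1) / 2)! := by
  rcases eq_or_lt_of_le hn with rfl | hn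
  · have := h8 rfl
    interval_cases r <;> decide
  · exact (choose_le_choose_of_le_of_two_mul_le (by omega) (by omega)).trans
      (choose_quarter_le_factorial hn)

end Nat

/-! ### Orders of imprimitive groups, and Bochert's theorem. -/

namespace Equiv.Perm

/-- A permutation group that preserves a partition into `b` parts of size `a`
has order at most `(a!) ^ b * b!`. -/
theorem card_le_of_preserves_fibers {α ι : Type*} [Finite α] [Fintype ι] (G : Subgroup (Perm α)) (f : α → ι)
    (hf : Function.Surjective f) {a : ℕ} (ha : ∀ i, {x | f x = i}.ncard = a)
    (hG : ∀ g ∈ G, ∀ x y, f x = f y → f (g x) = f (g y)) :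
    Nat.card G ≤ a.factorial ^ Fintype.card ι * (Fintype.card ι).factorial := by
  classical
  obtain ⟨s, hs⟩ := hf.hasRightInverse
  have hfs : ∀ g : G, ∀ x, f (g.1 (s (f x))) = f (g.1 x) := fun g x => hG g g.2 _ _ (hs _)
  -- The action on the parts, computed through the representatives `s i`; by `hG` their choice is
  -- irrelevant.
  let φ : G →* Function.End ι :=
    { toFun := fun g i => f (g.1 (s i))
      map_one' := by exact funext fun i => hs i
      map_mul' := by
        intro g h
        exact funext fun i => (hfs g (h.1 (s i))).symm }
  let ψ : G →* Perm ι := MulAction.toPermHom (Perm ι) ι |>.comp φ.toHomPerm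
  have hψ : ∀ g : G, ∀ i, ψ g i = f (g.1 (s i)) := fun _ _ => rfl
  have h1 : Nat.card ψ.range ≤ (Fintype.card ι).factorial := by
    rw [← Fintype.card_perm, ← Nat.card_eq_fintype_card]
    exact Nat.card_le_card_of_injective _ Subtype.val_injective
  have h2 : Nat.card ψ.ker ≤ a.factorial ^ Fintype.card ι := by
    have := DomMulAct.stabilizer_ncard (f := f)
    simp only [ha, Finset.prod_const, Finset.card_univ] at this
    rw [← this, ← Nat.card_coe_set_eq]
    refine Nat.card_le_card_of_injective
      (fun g => ⟨g.1.1, ?_⟩) fun g h hgh => Subtype.ext (Subtype.ext (Subtype.mk.inj hgh))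
    funext x
    have := (hψ g.1 (f x)).symm
    rw [hfs, MonoidHom.mem_ker.mp g.2] at this
    exact this
  rw [← ψ.ker.card_mul_index, Subgroup.index_ker]
  exact Nat.mul_le_mul h2 h1

variable {α : Type*} [DecidableEq α]

/-- If the supports of two permutations meet in a single point, their commutator is a 3-cycle. -/
theorem commutator_eq_swap_mul_swap {g h : Perm α} {c : α} (hg : g c ≠ c) (hh : h c ≠ c)
    (hgh : ∀ x, x ≠ c → g x = x ∨ h x = x) :
    g * h * g⁻¹ * h⁻¹ = swap c (h c) * swap c (g c) := by
  rw [mul_inv_eq_iff_eq_mul, mul_inv_eq_iff_eq_mul]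
  have hgi := g.injective
  have hhi := h.injective
  ext x
  simp only [coe_mul, Function.comp_apply, swap_apply_def]
  have h1 := hgh x
  have h2 := hgh (g x)
  have h3 := hgh (h x)
  have h4 := hgh (g c)
  have h5 := hgh (h c)
  have e1 := @hgi (g x) x
  have e2 := @hhi (h x) x
  have e3 := @hgi x c
  have e4 := @hhi x c
  have e5 := @hgi (g c) c
  have e6 := @hhi (h c) c
  by_cases k1 : x = c
  · subst k1
    split_ifs <;> grind
  · by_cases k2 : g x = c <;> by_cases k3 : h x = c <;> by_cases k4 : g x = x <;>
      split_ifs <;> grind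

variable [Fintype α]

/-- **Bochert's theorem**, for a group that is not assumed to be primitive. -/
theorem exists_isThreeCycle_mem_of_index_lt (G : Subgroup (Perm α))
    (hG : G.index < ((Fintype.card α + 1) / 2).factorial) : ∃ g ∈ G, g.IsThreeCycle := by
  classical
  let P : Finset α → Prop := fun Γ => ∀ g ∈ G, (∀ x ∈ Γ, g x = x) → g = 1
  -- `Γ` will be a base of `G` (trivial pointwise stabiliser) of least size.
  have hex : ∃ k, ∃ Γ, P Γ ∧ Γ.card = k :=
    ⟨_, Finset.univ, fun g _ h => Equiv.ext fun x => h x (Finset.mem_univ x), rfl⟩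
  obtain ⟨Γ, hΓ, hcard⟩ := Nat.find_spec hex
  have hmin : ∀ Δ : Finset α, Δ.card < Γ.card → ∃ g ∈ G, (∀ x ∈ Δ, g x = x) ∧ g ≠ 1 := by
    intro Δ hΔ
    have := Nat.find_min hex (hcard ▸ hΔ)
    by_contra! hcon
    exact this ⟨Δ, hcon, rfl⟩
  -- Permutations supported off a base lie in distinct cosets of `G`, so a base of at most half the
  -- points would make the index too large.
  have hΓn : Fintype.card α < 2 * Γ.card := by
    by_contra! hle
    refine hG.not_ge ?_
    let f : Perm {x // x ∉ Γ} → Perm α ⧸ G := fun p => QuotientGroup.mk (ofSubtype p)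
    have hf : Function.Injective f := by
      intro p q hpq
      have hmem : ofSubtype (p⁻¹ * q) ∈ G := by
        rw [map_mul, map_inv]
        exact QuotientGroup.eq.mp hpq
      have := hΓ _ hmem fun x hx => ofSubtype_apply_of_not_mem _ (by simpa using hx)
      rwa [map_eq_one_iff _ ofSubtype_injective, inv_mul_eq_one] at this
    have h1 := Nat.card_le_card_of_injective f hf
    rw [Nat.card_eq_fintype_card, Fintype.card_perm, Fintype.card_subtype_compl,
      Fintype.card_coe] at h1
    exact (Nat.factorial_le (by omega)).trans h1
  -- Both `Γᶜ` and `Γ` minus a point are smaller than `Γ`, hence not bases. This yields `g`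
  -- supported in `Γ` and `h` supported in `Γᶜ` plus `c`, with only `c` in common.
  obtain ⟨g, hgG, hg, hg1⟩ := hmin Γᶜ (by rw [Finset.card_compl]; omega)
  obtain ⟨c, hc⟩ : ∃ c, g c ≠ c := by
    by_contra! hcon
    exact hg1 (Equiv.ext hcon)
  have hcΓ : c ∈ Γ := by
    by_contra hcon
    exact hc (hg c (by simpa using hcon))
  obtain ⟨h, hhG, hh, hh1⟩ := hmin (Γ.erase c) (Finset.card_erase_lt_of_mem hcΓ)
  have hhc : h c ≠ c := by
    intro hcon
    refine hh1 (hΓ h hhG fun x hx => ?_)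
    rcases eq_or_ne x c with rfl | hxc
    · exact hcon
    · exact hh x (Finset.mem_erase.mpr ⟨hxc, hx⟩)
  have hgh : ∀ x, x ≠ c → g x = x ∨ h x = x := by
    intro x hx
    by_cases hxΓ : x ∈ Γ
    · exact Or.inr (hh x (Finset.mem_erase.mpr ⟨hx, hxΓ⟩))
    · exact Or.inl (hg x (by simpa using hxΓ))
  refine ⟨g * h * g⁻¹ * h⁻¹, G.mul_mem (G.mul_mem (G.mul_mem hgG hhG) (G.inv_mem hgG))
    (G.inv_mem hhG), ?_⟩
  rw [commutator_eq_swap_mul_swap hc hhc hgh]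
  refine isThreeCycle_swap_mul_swap_same hhc.symm hc.symm fun hcon => ?_
  rcases hgh (g c) hc with h1 | h1
  · exact hc (g.injective h1)
  · rw [← hcon] at h1
    exact hhc (h.injective h1)

end Equiv.Perm

/-! ### Transitive groups of small index, and large orbits. -/

namespace Equiv.Perm

variable {α : Type*}

open MulAction in
theorem exists_fibers_of_isBlock [Finite α] (G : Subgroup (Perm α)) [IsPretransitive G α]
    {B : Set α} (hB : IsBlock G B) (hne : B.Nonempty) :
    ∃ f : α → orbit G B, Function.Surjective f ∧ (∀ i, {x | f x = i}.ncard = B.ncard) ∧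
      ∀ g ∈ G, ∀ x y, f x = f y → f (g x) = f (g y) := by
  have hsys := (hB.isBlockSystem hne).1.2
  choose F hF hFu using hsys
  have hu : ∀ x (i : orbit G B), x ∈ i.1 → i.1 = F x := fun x i hx => hFu x i.1 ⟨i.2, hx⟩
  let f : α → orbit G B := fun x => ⟨F x, (hF x).1⟩
  have hf : ∀ x i, f x = i ↔ x ∈ i.1 := by
    intro x i
    refine ⟨?_, fun hx => Subtype.ext (hu x i hx).symm⟩
    rintro rfl
    exact (hF x).2
  refine ⟨f, ?_, ?_, ?_⟩
  · rintro ⟨_, g, rfl⟩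
    obtain ⟨x, hx⟩ := hne
    exact ⟨g • x, (hf _ _).mpr (Set.smul_mem_smul_set hx)⟩
  · rintro ⟨_, g, rfl⟩
    simp only [hf, Set.ofPred_mem_eq]
    exact Set.ncard_smul_set g B
  · intro g hg x y hxy
    let γ : G := ⟨g, hg⟩
    have h1 : ∀ z, f (g z) = γ • f z := fun z =>
      (hf _ _).mpr (Set.smul_mem_smul_set (a := γ) ((hf z (f z)).mp rfl))
    rw [h1, h1, hxy]

variable [DecidableEq α] [Fintype α]

-- In the primitive case Bochert supplies a 3-cycle for Jordan's theorem; a nontrivial block would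
-- bound the order of `G` too tightly for its index.
open MulAction in
theorem alternatingGroup_le_of_isPretransitive_of_index_lt (G : Subgroup (Perm α))
    [IsPretransitive G α] {r : ℕ} (hn : 8 ≤ Fintype.card α) (hr : 4 * r ≤ Fintype.card α)
    (h8 : Fintype.card α = 8 → r ≤ 1) (hG : G.index < (Fintype.card α).choose r) :
    alternatingGroup α ≤ G := by
  classical
  by_cases hprim : IsPreprimitive G α
  · obtain ⟨g, hgG, hg⟩ := exists_isThreeCycle_mem_of_index_lt G
      (hG.trans_le (Nat.choose_le_factorial_half hn hr h8))
    exact alternatingGroup_le_of_isPreprimitive_of_isThreeCycle_mem hprim hg hgG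
  · exfalso
    obtain ⟨B, hB, htriv⟩ : ∃ B : Set α, IsBlock G B ∧ ¬ IsTrivialBlock B := by
      by_contra! hcon
      exact hprim ⟨fun {B} hB => hcon B hB⟩
    rw [IsTrivialBlock, not_or, Set.not_subsingleton_iff] at htriv
    obtain ⟨hnt, huniv⟩ := htriv
    obtain ⟨f, hf, hfib, hfG⟩ := exists_fibers_of_isBlock G hB hnt.nonempty
    have hcard := card_le_of_preserves_fibers G f hf hfib hfG
    have hmul := hB.ncard_block_mul_ncard_orbit_eq hnt.nonempty
    rw [← Nat.card_coe_set_eq (orbit G B), Nat.card_eq_fintype_card, Nat.card_eq_fintype_card]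
      at hmul
    have ha : 2 ≤ B.ncard := Set.one_lt_ncard_iff_nontrivial.mpr hnt
    have hlt : B.ncard < Fintype.card α := by
      rw [← Nat.card_eq_fintype_card]
      exact Set.ncard_lt_card huniv
    have hb : 2 ≤ Fintype.card (orbit G B) := by
      by_contra! hcon
      have : B.ncard * Fintype.card (orbit G B) ≤ B.ncard * 1 := by gcongr; omega
      omega
    have key := Nat.factorial_pow_mul_factorial_mul_choose_le ha hb (hmul ▸ hn) (hmul ▸ hr)
    rw [hmul] at key
    have h1 := G.card_mul_index
    rw [Nat.card_eq_fintype_card (α := Perm α), Fintype.card_perm] at h1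
    have h2 : 0 < Nat.card G := Nat.card_pos
    have h3 : Nat.card G * G.index < Nat.card G * (Fintype.card α).choose r := by gcongr
    have h4 : Nat.card G * (Fintype.card α).choose r ≤ _ * (Fintype.card α).choose r :=
      Nat.mul_le_mul_right _ hcard
    omega

/-- A permutation group that preserves a set of size `j` has index at least `n.choose j`. -/
theorem choose_card_le_index_of_preserves (G : Subgroup (Perm α)) (s : Finset α)
    (hs : ∀ g ∈ G, ∀ x ∈ s, g x ∈ s) : (Fintype.card α).choose s.card ≤ G.index := by
  let S : Set.powersetCard α s.card := ⟨s, rfl⟩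
  have hle : G ≤ MulAction.stabilizer (Perm α) S := by
    intro g hg
    rw [MulAction.mem_stabilizer_iff]
    refine Subtype.ext (Finset.eq_of_subset_of_card_le ?_ ?_)
    · intro x hx
      obtain ⟨y, hy, rfl⟩ := Finset.mem_smul_finset.mp hx
      exact hs g hg y hy
    · exact (Finset.card_smul_finset g s).ge
  have := Set.powersetCard.isPretransitive (α := α) (n := s.card)
  have h1 := MulAction.index_stabilizer_of_transitive (Perm α) S
  rw [Set.powersetCard.card, Nat.card_eq_fintype_card] at h1
  rw [← h1]
  exact Nat.le_of_dvd (Nat.pos_of_ne_zero G.index_ne_zero_of_finite)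
    (Subgroup.index_dvd_of_le hle)

/-- A permutation group of small index has a large orbit. -/
theorem exists_large_orbit (G : Subgroup (Perm α)) {r : ℕ} (hr : 3 * r ≤ Fintype.card α)
    (hr1 : 1 ≤ r) (hG : G.index < (Fintype.card α).choose r) :
    ∃ x : α, Fintype.card α < (MulAction.orbit G x).ncard + r := by
  classical
  -- By unimodality of binomials, no invariant set has size between `r` and `n - r`.
  have hgap : ∀ s : Finset α, (∀ g ∈ G, ∀ x ∈ s, g x ∈ s) → r ≤ s.card →
      Fintype.card α < s.card + r := by
    intro s hs hrs
    by_contra! hcon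
    exact ((choose_card_le_index_of_preserves G s hs).trans_lt hG).not_ge
      (Nat.choose_le_choose_of_le_of_add_le hrs (by omega))
  obtain ⟨s, ⟨hs, hrs⟩, hmin⟩ := exists_minimal_of_wellFoundedLT
    (fun s : Finset α => (∀ g ∈ G, ∀ x ∈ s, g x ∈ s) ∧ r ≤ s.card)
    ⟨Finset.univ, fun _ _ _ _ => Finset.mem_univ _, by rw [Finset.card_univ]; omega⟩
  obtain ⟨x, hx⟩ : s.Nonempty := Finset.card_pos.mp (by omega)
  set t : Finset α := (MulAction.orbit G x).toFinset with ht
  have htinv : ∀ g ∈ G, ∀ y, g y ∈ t ↔ y ∈ t := by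
    intro g hg y
    simp only [ht, Set.mem_toFinset]
    rw [← MulAction.orbit_eq_iff, ← MulAction.orbit_eq_iff,
      ← MulAction.orbit_smul (⟨g, hg⟩ : G) y]
    rfl
  have hxt : x ∈ t := by simp [ht, MulAction.mem_orbit_self]
  have hts : t ⊆ s := by
    intro y hy
    obtain ⟨g, rfl⟩ := Set.mem_toFinset.mp hy
    exact hs g.1 g.2 x hx
  -- Otherwise `s \ t` would be a smaller invariant set of size at least `r`. So `t` has more than
  -- `n - 2 * r ≥ r` points, and `hgap` applies to it again.
  have hdiff : (s \ t).card < r := by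
    by_contra! hcon
    have := hmin (y := s \ t) ⟨fun g hg y hy => ?_, hcon⟩ Finset.sdiff_subset hx
    · exact (Finset.mem_sdiff.mp this).2 hxt
    · rw [Finset.mem_sdiff] at hy ⊢
      exact ⟨hs g hg y hy.1, fun h => hy.2 ((htinv g hg y).mp h)⟩
  have h1 := hgap s hs hrs
  have h2 := Finset.card_sdiff_add_card_eq_card hts
  refine ⟨x, ?_⟩
  rw [Set.ncard_eq_toFinset_card']
  exact hgap t (fun g hg y hy => (htinv g hg y).mpr hy) (by omega)

end Equiv.Perm

/-! ### The alternating group off a small set. -/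

namespace Equiv.Perm

variable {α : Type*} [DecidableEq α] [Fintype α]

/-- A subgroup that is normalised by the alternating group and has more than two elements
contains the alternating group. -/
theorem alternatingGroup_le_of_conj_mem (hα : 5 ≤ Nat.card α) (K : Subgroup (Perm α))
    (hK : ∀ a ∈ alternatingGroup α, ∀ k ∈ K, a * k * a⁻¹ ∈ K) (hcard : 2 < Nat.card K) :
    alternatingGroup α ≤ K := by
  have : (K.subgroupOf (alternatingGroup α)).Normal :=
    ⟨fun k hk a => Subgroup.mem_subgroupOf.mpr (hK a a.2 k (Subgroup.mem_subgroupOf.mp hk))⟩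
  rcases alternatingGroup.normal_subgroup_eq_bot_or_eq_top hα
    (N := K.subgroupOf (alternatingGroup α)) with h | h
  -- With trivial intersection with the alternating group, `sign` is injective on `K`, so `K` has
  -- order at most 2.
  · exfalso
    rw [Subgroup.subgroupOf_eq_bot, disjoint_iff] at h
    have hinj : Function.Injective (fun k : K => sign k.1) := by
      intro k l hkl
      have : k.1⁻¹ * l.1 ∈ K ⊓ alternatingGroup α := by
        refine ⟨K.mul_mem (K.inv_mem k.2) l.2, ?_⟩
        have hkl : sign k.1 = sign l.1 := hkl
        exact mem_alternatingGroup.mpr (by rw [map_mul, map_inv, hkl, inv_mul_cancel])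
      rw [h, Subgroup.mem_bot, inv_mul_eq_one] at this
      exact Subtype.ext this
    have := Nat.card_le_card_of_injective _ hinj
    simp at this
    omega
  · rwa [Subgroup.subgroupOf_eq_top] at h

/-- A permutation group of degree `n ≥ 9` and index less than `n.choose r`, where `r ≤ n / 4`,
contains the alternating group on the complement of a set of fewer than `r` points. -/
theorem exists_finset_forall_mem_of_index_lt (G : Subgroup (Perm α)) {r : ℕ}
    (hn : 9 ≤ Fintype.card α) (hr1 : 1 ≤ r) (hr : 4 * r ≤ Fintype.card α)
    (hG : G.index < (Fintype.card α).choose r) :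
    ∃ X : Finset α, X.card < r ∧
      ∀ π : Perm α, sign π = 1 → (∀ x ∈ X, π x = x) → π ∈ G := by
  classical
  obtain ⟨x₀, hx₀⟩ := exists_large_orbit G (by omega) hr1 hG
  set Γ := MulAction.orbit G x₀ with hΓ
  have hinv : ∀ g : G, ∀ y, g.1 y ∈ Γ ↔ y ∈ Γ := by
    intro g y
    rw [hΓ, ← MulAction.orbit_eq_iff, ← MulAction.orbit_eq_iff, ← MulAction.orbit_smul g y]
    rfl
  let φ : G →* Perm Γ := MulAction.toPermHom G Γ
  have hφ : ∀ (g : G) (y : Γ), (φ g y : α) = g.1 y := fun _ _ => rfl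
  let ψ : G →* Perm {y // y ∉ Γ} :=
    { toFun := fun g => g.1.subtypePerm fun y => not_congr (hinv g y)
      map_one' := rfl
      map_mul' := fun _ _ => rfl }
  have hψ : ∀ (g : G) (y : {y // y ∉ Γ}), (ψ g y : α) = g.1 y := fun _ _ => rfl
  have hinj : ∀ g h : G, φ g = φ h → ψ g = ψ h → g = h := by
    intro g h h1 h2
    refine Subtype.ext (Equiv.ext fun y => ?_)
    by_cases hy : y ∈ Γ
    · rw [← hφ g ⟨y, hy⟩, h1, hφ]
    · rw [← hψ g ⟨y, hy⟩, h2, hψ]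
  set n := Fintype.card α with hn_def
  set N := Fintype.card Γ with hN
  have hNcard : Γ.ncard = N := by rw [← Nat.card_coe_set_eq, Nat.card_eq_fintype_card]
  rw [hNcard] at hx₀
  obtain ⟨s, hs⟩ : ∃ s, N + s = n := ⟨n - N, by
    have : N ≤ n := Fintype.card_subtype_le _
    omega⟩
  have hscard : Fintype.card {y // y ∉ Γ} = s := by
    rw [Fintype.card_subtype_compl]
    change n - N = s
    omega
  -- The `s` points outside `Γ` use up part of `r`; on `Γ` the remaining budget is `q`.
  obtain ⟨q, rfl⟩ : ∃ q, r = s + q := ⟨r - s, by omega⟩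
  obtain ⟨M, hM⟩ : ∃ M, n = s + q + M := ⟨n - (s + q), by omega⟩
  have hNM : N = q + M := by omega
  have hGcard : (s + q).factorial * M.factorial < Nat.card G := by
    have h1 := G.card_mul_index
    rw [Nat.card_eq_fintype_card (α := Perm α), Fintype.card_perm, ← hn_def, hM,
      ← Nat.add_choose_mul_factorial_mul_factorial, ← Nat.choose_symm_add] at h1
    rw [hM] at hG
    by_contra! hcon
    have h2 : Nat.card G * G.index ≤ ((s + q).factorial * M.factorial) * G.index := by gcongr
    have h3 : ((s + q).factorial * M.factorial) * G.index <
      ((s + q).factorial * M.factorial) * (s + q + M).choose (s + q) := by gcongr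
    nlinarith
  -- The kernel of the action on `Γ` acts faithfully on the other `s` points.
  have hrange : Nat.card G ≤ s.factorial * Nat.card φ.range := by
    rw [← φ.ker.card_mul_index, Subgroup.index_ker, ← hscard, ← Fintype.card_perm,
      ← Nat.card_eq_fintype_card]
    refine Nat.mul_le_mul_right _ ?_
    refine Nat.card_le_card_of_injective (fun g : φ.ker => ψ g.1) fun g h hgh => ?_
    exact Subtype.ext (hinj _ _ ((MonoidHom.mem_ker.mp g.2).trans (MonoidHom.mem_ker.mp h.2).symm)
      hgh)
  have hfac : s.factorial * q.factorial ≤ (s + q).factorial :=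
    Nat.le_of_dvd (Nat.factorial_pos _) (Nat.factorial_mul_factorial_dvd_factorial_add s q)
  have hindex : φ.range.index < N.choose q := by
    have h1 := φ.range.card_mul_index
    rw [Nat.card_eq_fintype_card (α := Perm Γ), Fintype.card_perm, ← hN, hNM,
      ← Nat.add_choose_mul_factorial_mul_factorial, ← Nat.choose_symm_add] at h1
    rw [hNM]
    by_contra! hcon
    have h2 : q.factorial * M.factorial < Nat.card φ.range := by
      refine Nat.lt_of_mul_lt_mul_left (a := s.factorial) ?_
      calc _ = s.factorial * q.factorial * M.factorial := by ring
        _ ≤ (s + q).factorial * M.factorial := by gcongr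
        _ < _ := hGcard.trans_le hrange
    have h3 : 0 < (q + M).choose q := Nat.choose_pos (by omega)
    have h4 : q.factorial * M.factorial * (q + M).choose q <
      Nat.card φ.range * (q + M).choose q := by gcongr
    have h5 : Nat.card φ.range * (q + M).choose q ≤ Nat.card φ.range * φ.range.index := by gcongr
    nlinarith
  have htrans : MulAction.IsPretransitive φ.range Γ :=
    ⟨fun x y => by
      obtain ⟨g, hg⟩ := MulAction.exists_smul_eq G x y
      exact ⟨⟨φ g, g, rfl⟩, hg⟩⟩
  -- From `n ≥ 9` and `s < r ≤ n / 4` one gets `N ≥ 8`. If `N = 8` then `s ≥ 1` and `3 * s + 4 * q ≤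
  -- 8`, so `q ≤ 1`, as the exceptional degree requires.
  have hAlt : alternatingGroup Γ ≤ φ.range :=
    alternatingGroup_le_of_isPretransitive_of_index_lt φ.range (r := q) (by omega) (by omega)
      (by omega) hindex
  -- `K` consists of the permutations of `Γ` that lie in `G` when extended by the identity. It is
  -- the kernel of `ψ` seen on `Γ`, hence normalised by `φ.range`.
  let K : Subgroup (Perm Γ) := G.comap ofSubtype
  have hofSubtype : ∀ g : G, ψ g = 1 → ofSubtype (φ g) = g.1 := by
    intro g hg
    ext y
    by_cases hy : y ∈ Γ
    · rw [ofSubtype_apply_of_mem _ hy, hφ]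
    · rw [ofSubtype_apply_of_not_mem _ hy, ← hψ g ⟨y, hy⟩, hg]
      rfl
  have hKcard : 2 < Nat.card K := by
    have h1 : Nat.card G ≤ Nat.card K * s.factorial := by
      rw [← ψ.ker.card_mul_index, Subgroup.index_ker]
      refine Nat.mul_le_mul ?_ ?_
      · refine Nat.card_le_card_of_injective (fun g : ψ.ker => (⟨φ g.1, ?_⟩ : K)) fun g h hgh => ?_
        · change ofSubtype (φ g.1) ∈ G
          rw [hofSubtype _ (MonoidHom.mem_ker.mp g.2)]
          exact g.1.2
        · exact Subtype.ext (hinj _ _ (Subtype.mk.inj hgh)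
            ((MonoidHom.mem_ker.mp g.2).trans (MonoidHom.mem_ker.mp h.2).symm))
      · rw [← hscard, ← Fintype.card_perm, ← Nat.card_eq_fintype_card]
        exact Nat.card_le_card_of_injective _ Subtype.val_injective
    by_contra! hcon
    have h2 : (2).factorial ≤ M.factorial := Nat.factorial_le (by omega)
    have h3 : s.factorial ≤ (s + q).factorial := Nat.factorial_le (by omega)
    have h4 : Nat.card K * s.factorial ≤ M.factorial * (s + q).factorial :=
      Nat.mul_le_mul (hcon.trans h2) h3
    nlinarith
  have hAltK : alternatingGroup Γ ≤ K := by
    refine alternatingGroup_le_of_conj_mem (by rw [Nat.card_eq_fintype_card]; omega) K ?_ hKcard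
    intro a ha k hk
    obtain ⟨g, rfl⟩ := hAlt ha
    have : ofSubtype (φ g * k * (φ g)⁻¹) = g.1 * ofSubtype k * g.1⁻¹ := by
      rw [eq_mul_inv_iff_mul_eq]
      ext y
      rw [mul_apply, mul_apply]
      by_cases hy : y ∈ Γ
      · have h1 : g.1 y = (φ g ⟨y, hy⟩ : Γ) := rfl
        rw [h1, ofSubtype_apply_coe, ofSubtype_apply_of_mem _ hy]
        simp [hφ]
      · rw [ofSubtype_apply_of_not_mem _ hy, ofSubtype_apply_of_not_mem]
        exact fun h => hy ((hinv g y).mp h)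
    change ofSubtype (φ g * k * (φ g)⁻¹) ∈ G
    rw [this]
    exact G.mul_mem (G.mul_mem g.2 hk) (G.inv_mem g.2)
  refine ⟨Γᶜ.toFinset, ?_, ?_⟩
  · rw [← Set.ncard_eq_toFinset_card', ← Nat.card_coe_set_eq, Nat.card_eq_fintype_card]
    have : Fintype.card ↑Γᶜ = Fintype.card {y // y ∉ Γ} := Fintype.card_congr (Equiv.refl _)
    omega
  · intro π hπ hfix
    have hfix' : ∀ y, y ∉ Γ → π y = y := fun y hy => hfix y (by simpa using hy)
    have h1 : ∀ y, π y ∈ Γ ↔ y ∈ Γ := by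
      intro y
      constructor
      · intro h
        by_contra hy
        exact hy (hfix' y hy ▸ h)
      · intro hy
        by_contra h
        exact h (by rwa [π.injective (hfix' _ h)])
    have h2 : ofSubtype (π.subtypePerm h1) = π :=
      ofSubtype_subtypePerm h1 fun y hy => by
        by_contra h
        exact hy (hfix' y h)
    have h3 : π.subtypePerm h1 ∈ K := by
      refine hAltK ?_
      rw [mem_alternatingGroup, ← sign_ofSubtype, h2, hπ]
    rw [← h2]
    exact h3

end Equiv.Perm

/-! ### Lifting permutations of one block to the tree. -/

namespace TreeNode

variable {h : ℕ} {k : Fin h → ℕ}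

/-- `w` and `v` have the same ancestors above the level of `v` (as far as `w` has
ancestors there). -/
def AgreesAbove (v w : TreeNode k) : Prop :=
  ∀ (i : Fin h) (hw : (w.1 : ℕ) ≤ i) (hv : (v.1 : ℕ) ≤ i), (v.1 : ℕ) < i →
    w.2 ⟨i, hw⟩ = v.2 ⟨i, hv⟩

/-- The index of the choice that distinguishes `v` from the other nodes of its block. -/
def lastIndex (v : TreeNode k) (hv : v.level < h) : Fin h := ⟨v.level, hv⟩

open Classical in
/-- Permute the choices at the parent of `v`, moving whole subtrees. -/
noncomputable def permuteAt (v : TreeNode k) (hv : v.level < h)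
    (e : Equiv.Perm (Fin (k (v.lastIndex hv)))) (w : TreeNode k) : TreeNode k :=
  ⟨w.1, fun i => if AgreesAbove v w then
    (Pi.mulSingle (v.lastIndex hv) e : ∀ i, Equiv.Perm (Fin (k i))) i.1 (w.2 i) else w.2 i⟩

variable {v : TreeNode k} (hv : v.level < h)

theorem permuteAt_apply_of_agreesAbove {w : TreeNode k} (hw : AgreesAbove v w)
    (e : Equiv.Perm (Fin (k (v.lastIndex hv)))) (i : {i : Fin h // (w.1 : ℕ) ≤ i}) :
    (permuteAt v hv e w).2 i =
      (Pi.mulSingle (v.lastIndex hv) e : ∀ i, Equiv.Perm (Fin (k i))) i.1 (w.2 i) :=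
  if_pos hw

theorem permuteAt_of_not_agreesAbove {w : TreeNode k} (hw : ¬ AgreesAbove v w)
    (e : Equiv.Perm (Fin (k (v.lastIndex hv)))) : permuteAt v hv e w = w :=
  congrArg (Sigma.mk w.1) (funext fun _ => if_neg hw)

theorem permuteAt_apply_of_ne (w : TreeNode k)
    (e : Equiv.Perm (Fin (k (v.lastIndex hv)))) (i : {i : Fin h // (w.1 : ℕ) ≤ i})
    (hi : i.1 ≠ v.lastIndex hv) : (permuteAt v hv e w).2 i = w.2 i := by
  by_cases hw : AgreesAbove v w
  · rw [permuteAt_apply_of_agreesAbove hv hw, Pi.mulSingle_eq_of_ne hi]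
    rfl
  · exact if_neg hw

theorem ne_lastIndex_of_lt {i : Fin h} (hi : (v.1 : ℕ) < i) : i ≠ v.lastIndex hv := by
  rintro rfl
  exact lt_irrefl _ hi

theorem agreesAbove_permuteAt (e : Equiv.Perm (Fin (k (v.lastIndex hv)))) (w : TreeNode k) :
    AgreesAbove v (permuteAt v hv e w) ↔ AgreesAbove v w := by
  have key : ∀ (i : Fin h) (hw : (w.1 : ℕ) ≤ i), (v.1 : ℕ) < i →
      (permuteAt v hv e w).2 ⟨i, hw⟩ = w.2 ⟨i, hw⟩ := fun i hw hi =>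
    permuteAt_apply_of_ne hv w e ⟨i, hw⟩ (ne_lastIndex_of_lt hv hi)
  exact ⟨fun H i hw hv' hi => (key i hw hi).symm.trans (H i hw hv' hi),
    fun H i hw hv' hi => (key i hw hi).trans (H i hw hv' hi)⟩

theorem permuteAt_one (w : TreeNode k) : permuteAt v hv 1 w = w := by
  refine congrArg (Sigma.mk w.1) (funext fun i => ?_)
  rw [Pi.mulSingle_one]
  exact ite_self _

theorem permuteAt_mul (e e' : Equiv.Perm (Fin (k (v.lastIndex hv)))) (w : TreeNode k) :
    permuteAt v hv (e * e') w = permuteAt v hv e (permuteAt v hv e' w) := by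
  by_cases hw : AgreesAbove v w
  · refine congrArg (Sigma.mk w.1) (funext fun i => ?_)
    have h1 := permuteAt_apply_of_agreesAbove hv hw (e * e') i
    have h2 := permuteAt_apply_of_agreesAbove hv ((agreesAbove_permuteAt hv e' w).mpr hw) e i
    rw [permuteAt_apply_of_agreesAbove hv hw, ← Equiv.Perm.mul_apply, ← Pi.mul_apply,
      ← Pi.mulSingle_mul] at h2
    exact h1.trans h2.symm
  · rw [permuteAt_of_not_agreesAbove hv hw, permuteAt_of_not_agreesAbove hv hw,
      permuteAt_of_not_agreesAbove hv hw]

theorem IsChild.permuteAt {w u : TreeNode k} (hwu : IsChild w u)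
    (e : Equiv.Perm (Fin (k (v.lastIndex hv)))) :
    IsChild (permuteAt v hv e w) (permuteAt v hv e u) := by
  refine ⟨hwu.1, fun i hw hu => ?_⟩
  have hlev : (w.1 : ℕ) + 1 = u.1 := hwu.1
  have hwu2 := hwu.2 i hw hu
  by_cases hi : i = v.lastIndex hv
  · have hiv : (i : ℕ) = v.1 := congrArg Fin.val hi
    have hu' : (u.1 : ℕ) ≤ v.1 := hiv ▸ hu
    have hiff : AgreesAbove v w ↔ AgreesAbove v u :=
      ⟨fun H i hui hvi hi => (hwu.2 i (by omega) hui).symm.trans (H i (by omega) hvi hi),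
        fun H i hwi hvi hi => (hwu.2 i hwi (by omega)).trans (H i (by omega) hvi hi)⟩
    by_cases H : AgreesAbove v w
    · have h1 := permuteAt_apply_of_agreesAbove hv H e ⟨i, hw⟩
      have h2 := permuteAt_apply_of_agreesAbove hv (hiff.mp H) e ⟨i, hu⟩
      rw [← hwu2] at h2
      exact h1.trans h2.symm
    · exact (if_neg H).trans (hwu2.trans (if_neg (mt hiff.mpr H)).symm)
  · exact (permuteAt_apply_of_ne hv w e ⟨i, hw⟩ hi).trans
      (hwu2.trans (permuteAt_apply_of_ne hv u e ⟨i, hu⟩ hi).symm)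

/-- A node lies below at most one child of the parent of `v`, so it moves only if that child does.
Applied to leaves, this lets a transposition avoid any given variable. -/
theorem permuteAt_eq_self_of_fixes (w : TreeNode k) :
    ∃ c, ∀ e : Equiv.Perm (Fin (k (v.lastIndex hv))), e c = c → permuteAt v hv e w = w := by
  by_cases hw : (w.1 : ℕ) ≤ v.1
  · refine ⟨w.2 ⟨v.lastIndex hv, hw⟩, fun e he => ?_⟩
    by_cases H : AgreesAbove v w
    · refine congrArg (Sigma.mk w.1) (funext fun i => ?_)
      obtain ⟨i, hi⟩ := i
      refine (permuteAt_apply_of_agreesAbove hv H e ⟨i, hi⟩).trans ?_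
      by_cases hij : i = v.lastIndex hv
      · subst hij
        rwa [Pi.mulSingle_eq_same]
      · rw [Pi.mulSingle_eq_of_ne hij]
        rfl
    · exact permuteAt_of_not_agreesAbove hv H e
  · refine ⟨v.2 ⟨v.lastIndex hv, le_rfl⟩, fun e _ => ?_⟩
    refine congrArg (Sigma.mk w.1) (funext fun i => ?_)
    refine permuteAt_apply_of_ne hv w e i ?_
    have := i.2
    exact ne_lastIndex_of_lt hv (by omega)

/-- The lift of permutations of the choices at the parent of `v` to the tree. -/
noncomputable def permuteAtHom :
    Equiv.Perm (Fin (k (v.lastIndex hv))) →* treeAut k where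
  toFun e := ⟨⟨permuteAt v hv e, permuteAt v hv e⁻¹,
      fun w => by rw [← permuteAt_mul, inv_mul_cancel, permuteAt_one],
      fun w => by rw [← permuteAt_mul, mul_inv_cancel, permuteAt_one]⟩,
    fun w u => by
      refine ⟨fun H => ?_, fun H => H.permuteAt hv e⟩
      have := IsChild.permuteAt hv H e⁻¹
      simpa only [Equiv.coe_fn_mk, ← permuteAt_mul, inv_mul_cancel, permuteAt_one] using this⟩
  map_one' := Subtype.ext (Equiv.ext fun w => permuteAt_one hv w)
  map_mul' e e' := Subtype.ext (Equiv.ext fun w => permuteAt_mul hv e e' w)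

/-- The node that differs from `v` at most in the choice made at the parent of `v`. -/
def sibling (c : Fin (k (v.lastIndex hv))) : TreeNode k :=
  ⟨v.1, Function.update v.2 ⟨v.lastIndex hv, le_rfl⟩ c⟩

theorem sibling_injective : Function.Injective (sibling hv) := fun _ _ hcc' =>
  Function.update_injective v.2 ⟨v.lastIndex hv, le_rfl⟩ (eq_of_heq (Sigma.mk.inj hcc').2)

theorem agreesAbove_sibling (c : Fin (k (v.lastIndex hv))) : AgreesAbove v (sibling hv c) := by
  intro i hw hv' hi
  exact Function.update_of_ne (fun H => ne_lastIndex_of_lt hv hi (congrArg Subtype.val H)) _ _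

theorem permuteAt_sibling (e : Equiv.Perm (Fin (k (v.lastIndex hv))))
    (c : Fin (k (v.lastIndex hv))) : permuteAt v hv e (sibling hv c) = sibling hv (e c) := by
  refine congrArg (Sigma.mk v.1) (funext fun i => ?_)
  refine (permuteAt_apply_of_agreesAbove hv (agreesAbove_sibling hv c) e i).trans ?_
  by_cases hi : i = ⟨v.lastIndex hv, le_rfl⟩
  · subst hi
    simp [sibling]
  · have : i.1 ≠ v.lastIndex hv := fun H => hi (Subtype.ext H)
    rw [Pi.mulSingle_eq_of_ne this]
    exact (Function.update_of_ne hi _ _).trans (Function.update_of_ne hi _ _).symm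

theorem range_sibling : Set.range (sibling hv) = block v := by
  ext w
  constructor
  · rintro ⟨c, rfl⟩ p
    refine and_congr_right fun hp => forall_congr' fun i => ?_
    have key : ∀ hi : (p.1 : ℕ) ≤ i, ∀ hvi : (v.1 : ℕ) ≤ i,
        (sibling hv c).2 ⟨i, hvi⟩ = v.2 ⟨i, hvi⟩ := fun hi hvi =>
      agreesAbove_sibling hv c i hvi hvi (lt_of_lt_of_le (Nat.lt_of_succ_le hp.le) hi)
    exact ⟨fun H hvi hi => (key hi hvi).symm.trans (H hvi hi),
      fun H hvi hi => (key hi hvi).trans (H hvi hi)⟩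
  · intro hw
    obtain ⟨p, hp⟩ := exists_isChild hv
    have hwp : IsChild w p := (hw p).mpr hp
    obtain ⟨w1, w2⟩ := w
    obtain rfl : w1 = v.1 := Fin.ext (Nat.succ_injective (hwp.1.trans hp.1.symm))
    refine ⟨w2 ⟨v.lastIndex hv, le_rfl⟩, congrArg (Sigma.mk v.1) (funext fun i => ?_)⟩
    by_cases hi : i = ⟨v.lastIndex hv, le_rfl⟩
    · subst hi
      exact Function.update_self _ _ _
    · refine (Function.update_of_ne hi _ _).trans ?_
      have hlt : (v.1 : ℕ) < i.1 :=
        lt_of_le_of_ne i.2 fun H => hi (Subtype.ext (Fin.ext H.symm))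
      have hpi : (p.1 : ℕ) ≤ i.1 := hp.1.symm.le.trans hlt
      exact (hp.2 i.1 i.2 hpi).trans (hwp.2 i.1 i.2 hpi).symm

end TreeNode

/-! ### From even to arbitrary permutations by rigidity. -/

namespace ModCircuit

variable {m : ℕ} {X V Γ : Type*} [Group Γ] [MulAction Γ X] {C : ModCircuit m X V}

theorem gateAction_extends (hs : C.IsSymmetric Γ) (hr : C.IsRigid Γ) (π : Γ) :
    C.Extends π (gateAction hs hr π) :=
  (hs π).choose_spec

open Equiv.Perm in
/-- If every even permutation fixing few points fixes a gate, then so does every permutation. -/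
theorem gateAction_eq_of_forall_even [Finite V] {β : Type*} [DecidableEq β] [Fintype β]
    (hs : C.IsSymmetric Γ) (hr : C.IsRigid Γ) (ρ : Equiv.Perm β →* Γ)
    (hρ : ∀ x : X, ∃ c, ∀ e, e c = c → ρ e • x = x) (S : V → Finset β)
    (hS : ∀ v, 2 * (S v).card + 2 ≤ Fintype.card β)
    (hS1 : ∀ v, (S v).card + 3 ≤ Fintype.card β)
    (heven : ∀ v e, sign e = 1 → (∀ x ∈ S v, e x = x) → gateAction hs hr (ρ e) v = v)
    (v : V) (e : Equiv.Perm β) (he : ∀ x ∈ S v, e x = x) : gateAction hs hr (ρ e) v = v := by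
  set A : Equiv.Perm β →* Equiv.Perm V := (gateAction hs hr).comp ρ with hA
  have hAext : ∀ e, C.Extends (ρ e) (A e) := fun e => gateAction_extends hs hr (ρ e)
  have hpick : ∀ T : Finset β, T.card + 2 ≤ Fintype.card β → ∃ a b, a ≠ b ∧ a ∉ T ∧ b ∉ T := by
    intro T hT
    have : 1 < Tᶜ.card := by rw [Finset.card_compl]; omega
    obtain ⟨a, ha, b, hb, hab⟩ := Finset.one_lt_card.mp this
    exact ⟨a, b, hab, Finset.mem_compl.mp ha, Finset.mem_compl.mp hb⟩
  have hfix : ∀ (v : V) {a b : β}, a ∉ S v → b ∉ S v → ∀ x ∈ S v, Equiv.swap a b x = x :=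
    fun v a b ha hb x hx => Equiv.swap_apply_of_ne_of_ne (fun h => ha (h ▸ hx))
      fun h => hb (h ▸ hx)
  choose a b hab ha hb using fun v => hpick (S v) (by have := hS1 v; omega)
  -- Two odd permutations fixing `S v` differ by an even one fixing `S v`, so `τ v` does not depend
  -- on the chosen transposition.
  let τ : V → V := fun v => A (Equiv.swap (a v) (b v)) v
  have hodd : ∀ (v : V) (e : Equiv.Perm β), sign e = -1 → (∀ x ∈ S v, e x = x) → A e v = τ v := by
    intro v e hsign he
    have h1 : A ((Equiv.swap (a v) (b v))⁻¹ * e) v = v := by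
      refine heven v _ ?_ fun x hx => ?_
      · rw [map_mul, map_inv, sign_swap (hab v), hsign]
        decide
      · rw [mul_apply, he x hx, inv_eq_iff_eq, hfix v (ha v) (hb v) x hx]
    rwa [map_mul, map_inv, mul_apply, inv_eq_iff_eq] at h1
  have hswap : ∀ (v : V) {c d : β}, c ≠ d → c ∉ S v → d ∉ S v → A (Equiv.swap c d) v = τ v :=
    fun v c d hcd hc hd => hodd v _ (sign_swap hcd) (hfix v hc hd)
  -- Two supports leave two points free, so one circuit automorphism agrees with `τ` at both gates.
  -- Injectivity and wire multiplicities, which involve two gates at a time, therefore pass to `τ`.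
  have hpair : ∀ u v : V, ∃ e, A e u = τ u ∧ A e v = τ v := by
    intro u v
    obtain ⟨c, d, hcd, hc, hd⟩ := hpick (S u ∪ S v) (by
      have := Finset.card_union_le (S u) (S v)
      have := hS u
      have := hS v
      omega)
    rw [Finset.mem_union, not_or] at hc hd
    exact ⟨Equiv.swap c d, hswap u hcd hc.1 hd.1, hswap v hcd hc.2 hd.2⟩
  have hτinj : Function.Injective τ := by
    intro u v huv
    obtain ⟨e, h1, h2⟩ := hpair u v
    exact (A e).injective (h1.trans (huv.trans h2.symm))
  let σ : Equiv.Perm V := Equiv.ofBijective τ (Finite.injective_iff_bijective.mp hτinj)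
  have hσ : C.Extends (1 : Γ) σ := by
    refine ⟨fun g x hg => ?_, fun g R hg => ?_, fun g g' => ?_⟩
    · obtain ⟨c₀, hc₀⟩ := hρ x
      -- Avoiding `c₀` as well keeps the variable `x` fixed; this is why `hS1` asks for three spare
      -- points.
      obtain ⟨c, d, hcd, hc, hd⟩ := hpick (insert c₀ (S g)) (by
        have := Finset.card_insert_le c₀ (S g)
        have := hS1 g
        omega)
      rw [Finset.mem_insert, not_or] at hc hd
      have h1 := (hAext (Equiv.swap c d)).1 g x hg
      rw [hswap g hcd hc.2 hd.2,
        hc₀ _ (Equiv.swap_apply_of_ne_of_ne (Ne.symm hc.1) (Ne.symm hd.1))] at h1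
      rwa [one_smul]
    · exact (hAext _).2.1 g R hg
    · obtain ⟨e, h1, h2⟩ := hpair g g'
      have := (hAext e).2.2 g g'
      rwa [h1, h2] at this
  have hσ1 : σ = 1 := hr 1 σ 1 hσ Extends.one
  have hτ : ∀ v, τ v = v := fun v => congrArg (fun s : Equiv.Perm V => s v) hσ1
  rcases Int.units_eq_one_or (sign e) with h | h
  · exact heven v e h he
  · exact (hodd v e h he).trans (hτ v)

/-- A gate of a rigid symmetric circuit whose orbits under `Equiv.Perm β` are small
has a small support. -/
theorem exists_finset_forall_gateAction_eq [Finite V] {β : Type*} [DecidableEq β] [Fintype β]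
    (hs : C.IsSymmetric Γ) (hr : C.IsRigid Γ) (ρ : Equiv.Perm β →* Γ)
    (hρ : ∀ x : X, ∃ c, ∀ e, e c = c → ρ e • x = x) {r : ℕ} (hβ : 9 ≤ Fintype.card β)
    (hr1 : 1 ≤ r) (hr4 : 4 * r ≤ Fintype.card β)
    (horb : ∀ v, (gateOrbit hs hr ρ.range v).ncard < (Fintype.card β).choose r) (v : V) :
    ∃ S : Finset β, S.card < r ∧
      ∀ e : Equiv.Perm β, (∀ x ∈ S, e x = x) → gateAction hs hr (ρ e) v = v := by
  let A : Equiv.Perm β →* Equiv.Perm V := (gateAction hs hr).comp ρ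
  let _ : MulAction (Equiv.Perm β) V := MulAction.compHom V A
  have hindex : ∀ v : V, (MulAction.stabilizer (Equiv.Perm β) v).index <
      (Fintype.card β).choose r := by
    intro v
    rw [MulAction.index_stabilizer]
    convert horb v using 2
    ext u
    constructor
    · rintro ⟨e, he⟩
      exact ⟨ρ e, ⟨e, rfl⟩, he⟩
    · rintro ⟨_, ⟨e, rfl⟩, he⟩
      exact ⟨e, he⟩
  choose S hS hSmem using fun v =>
    Equiv.Perm.exists_finset_forall_mem_of_index_lt (MulAction.stabilizer (Equiv.Perm β) v) hβ hr1 hr4 (hindex v)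
  refine ⟨S v, hS v, gateAction_eq_of_forall_even hs hr ρ hρ S ?_ ?_
    (fun v e h1 h2 => hSmem v e h1 h2) v⟩
  · intro v
    have := hS v
    omega
  · intro v
    have := hS v
    omega

theorem ncard_gateOrbit_le_maxOrb [Finite V] (hs : C.IsSymmetric Γ) (hr : C.IsRigid Γ)
    {Δ Δ' : Subgroup Γ} (hΔ : Δ ≤ Δ') (g : V) :
    (gateOrbit hs hr Δ g).ncard ≤ maxOrb hs hr Δ' := by
  refine le_trans (Set.ncard_le_ncard ?_ (Set.toFinite _))
    (le_ciSup (f := fun g : V => (gateOrbit hs hr Δ' g).ncard) (Set.finite_range _).bddAbove g)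
  rintro _ ⟨π, hπ, rfl⟩
  exact ⟨π, hΔ hπ, rfl⟩

end ModCircuit

/-! ### Supports on the blocks of the tree. -/

open TreeNode in
theorem ncard_block_le_one_of_level_eq {h : ℕ} {k : Fin h → ℕ} {v : TreeNode k}
    (hv : v.level = h) : (block v).ncard ≤ 1 := by
  rw [Set.ncard_le_one_iff_subsingleton]
  have hroot : ∀ w ∈ block v, (w.1 : ℕ) = h := by
    intro w hw
    by_contra hne
    obtain ⟨p, hp⟩ := exists_isChild (v := w) (lt_of_le_of_ne w.level_le hne)
    have h1 : v.level + 1 = p.level := ((hw p).mp hp).1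
    have := p.level_le
    omega
  intro w hw u hu
  have h1 := hroot w hw
  have h2 := hroot u hu
  obtain ⟨w1, w2⟩ := w
  obtain ⟨u1, u2⟩ := u
  obtain rfl : w1 = u1 := Fin.ext (h1.trans h2.symm)
  refine congrArg (Sigma.mk w1) (funext fun i => ?_)
  have := i.2
  have := i.1.2
  simp only at h1
  omega

open TreeNode in
theorem mainTheorem7 (m : ℕ) {h : ℕ} (k : Fin h → ℕ) (hk : ∀ i, 8 < k i)
    {V : Type*} [Finite V] (C : ModCircuit m (TreeLeaf k) V)
    (hs : C.IsSymmetric (treeAut k)) (hr : C.IsRigid (treeAut k))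
    (B : Set (TreeNode k)) (hB : B ∈ treeBlocks k)
    (kB : ℕ) (hkB : 1 ≤ kB) (hkB' : (kB : ℝ) ≤ (B.ncard : ℝ) / 4)
    (horb : ModCircuit.maxOrb hs hr (MulAction.stabilizer (treeAut k) B) < B.ncard.choose kB)
    (g : V) :
    ∃ S : Set (TreeNode k), IsBlockSupport (ModCircuit.gateStab hs hr g) B S ∧ S.ncard < kB := by
  obtain ⟨v, rfl⟩ := hB
  have h4 : 4 * kB ≤ (block v).ncard := by
    rw [le_div_iff₀ (by norm_num)] at hkB'
    rw [mul_comm]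
    exact_mod_cast hkB'
  -- The block of the root is a singleton, which `4 ≤ 4 * kB ≤ |B|` rules out.
  have hv : v.level < h := by
    refine lt_of_le_of_ne v.level_le fun hv => ?_
    have := ncard_block_le_one_of_level_eq hv
    omega
  have hncard : (block v).ncard = k (v.lastIndex hv) := by
    rw [← range_sibling hv, ← Set.image_univ, Set.ncard_image_of_injective _ (sibling_injective hv),
      Set.ncard_univ, Nat.card_eq_fintype_card, Fintype.card_fin]
  have hsib : ∀ (e : Equiv.Perm (Fin (k (v.lastIndex hv)))) c,
      permuteAtHom hv e • sibling hv c = sibling hv (e c) := permuteAt_sibling hv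
  have hstab : ∀ e, permuteAtHom hv e • block v = block v := by
    intro e
    rw [← range_sibling hv, ← Set.image_smul, ← Set.range_comp]
    exact (congrArg Set.range (funext fun c => hsib e c)).trans (e.surjective.range_comp (sibling hv))
  have hrange : (permuteAtHom hv).range ≤ MulAction.stabilizer (treeAut k) (block v) := by
    rintro _ ⟨e, rfl⟩
    exact hstab e
  obtain ⟨S, hS, hSg⟩ := ModCircuit.exists_finset_forall_gateAction_eq hs hr (permuteAtHom hv)
    (fun x => (permuteAt_eq_self_of_fixes hv x.1).imp fun c hc e he => Subtype.ext (hc e he))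
    (r := kB) (by rw [Fintype.card_fin]; exact hk _) hkB
    (by rw [Fintype.card_fin, ← hncard]; exact h4)
    (fun u => (ModCircuit.ncard_gateOrbit_le_maxOrb hs hr hrange u).trans_lt
      (by rwa [Fintype.card_fin, ← hncard])) g
  let ε : Fin (k (v.lastIndex hv)) ≃ block v :=
    (Equiv.ofInjective _ (sibling_injective hv)).trans (Equiv.setCongr (range_sibling hv))
  have hε : ∀ c, (ε c : TreeNode k) = sibling hv c := fun _ => rfl
  refine ⟨sibling hv '' S, ⟨?_, ?_⟩, ?_⟩
  · rw [← range_sibling hv]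
    exact Set.image_subset_range _ _
  · intro π hπ
    -- `π` is transported to the choices at the parent; its lift is the witness that induces `π` on
    -- the block.
    let e : Equiv.Perm (Fin (k (v.lastIndex hv))) := (ε.trans π).trans ε.symm
    have he : ∀ c, ε (e c) = π (ε c) := fun c => ε.apply_symm_apply _
    refine ⟨permuteAtHom hv e, hSg e fun c hc => ?_, hstab e, fun b => ?_⟩
    · refine ε.injective ((he c).trans ?_)
      exact (mem_fixingSubgroup_iff _).mp hπ (ε c) ⟨c, hc, (hε c).symm⟩
    · obtain ⟨c, rfl⟩ := ε.surjective b
      rw [← he, hε, hε, hsib]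
  · rw [Set.ncard_image_of_injective _ (sibling_injective hv), Set.ncard_coe_finset]
    exact hS
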